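/- Let $d\ge 2$ and let $S^d$ be the unit sphere of $\mathbb{R}^{d+1}$. The spherical distance $|ab|$ of $a,b\in S^d$ is the length of the shorter great-circle arc joining them (so $|ab|=\pi$ for antipodes). A set $C\subset S^d$ is convex if it contains no pair of antipodes and if, with any two points $a,b\in C$, it contains the shorter great-circle arc $ab$; a spherical convex body is a closed convex subset of $S^d$ with non-empty interior. For $m\in S^d$ let $H(m)=\{x\in S^d:|mx|\le \pi/2\}$ be the hemisphere with center $m$. It supports a spherical convex body $C$ if $C\subset H(m)$ and $\mathrm{bd}(C)\cap\mathrm{bd}(H(m))\neq\emptyset$. If hemispheres $G,H$ are different and not opposite (that is, their centers are neither equal nor antipodal), then $G\cap H$ is a lune; it is bounded by the two $(d-1)$-dimensional hemispheres $\mathrm{bd}(G)\cap H$ and $\mathrm{bd}(H)\cap G$, and its thickness is the spherical distance of the centers of these two. The width of $C$ determined by a supporting hemisphere $K$ of $C$ is the minimum of the thicknesses of the lunes $K\cap K'$ over all hemispheres $K'$ supporting $C$ (different from $K$). The body $C$ is of constant width $w$ if its width determined by every supporting hemisphere equals $w$. The body $C$ is of constant diameter $w$ if $\sup_{p,q\in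 C}|pq|=w$ and for every $p\in\mathrm{bd}(C)$ there is $p'\in C$ with $|pp'|=w$. **Theorem.** Let $W\subset S^d$ be a spherical convex body and let $w$ be a real number. 1. If $W$ is of constant width $w$, then $W$ is of constant diameter $w$. 2. If $w\ge\frac{\pi}{2}$ and $W$ is of constant diameter $w$, then $W$ is of constant width $w$. -/

import Mathlib

namespace SphConvex

/-- The unit sphere `S^d` of the Euclidean space `E^{d+1}`, with its subspace topology. -/
abbrev Sph (d : ℕ) : Type := Metric.sphere (0 : EuclideanSpace ℝ (Fin (d + 1))) 1

variable {d : ℕ}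

/-- The spherical distance `|ab|`: the length of the shorter great-circle arc from `a` to `b`,
that is, the angle between the two unit vectors (`0` for equal points, `π` for antipodes). -/
noncomputable def sdist (a b : Sph d) : ℝ :=
  InnerProductGeometry.angle (a : EuclideanSpace ℝ (Fin (d + 1)))
    (b : EuclideanSpace ℝ (Fin (d + 1)))

/-- The arc `ab`, the shorter part of the great circle through `a` and `b`: the points of the
sphere in the cone spanned by `a` and `b`. It is meant for points that are not antipodes. -/
def arc (a b : Sph d) : Set (Sph d) :=
  {x | ∃ s t : ℝ, 0 ≤ s ∧ 0 ≤ t ∧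
    (x : EuclideanSpace ℝ (Fin (d + 1))) =
      s • (a : EuclideanSpace ℝ (Fin (d + 1))) + t • (b : EuclideanSpace ℝ (Fin (d + 1)))}

/-- A set is (spherically) convex if it contains no pair of antipodes and contains the arc
between any two of its points. -/
def IsConvex (C : Set (Sph d)) : Prop :=
  (∀ a ∈ C, -a ∉ C) ∧ ∀ a ∈ C, ∀ b ∈ C, arc a b ⊆ C

/-- A spherical convex body: a closed convex set with non-empty interior. -/
def IsConvexBody (C : Set (Sph d)) : Prop :=
  IsClosed C ∧ IsConvex C ∧ (interior C).Nonempty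

/-- The hemisphere `H(m)` with center `m`. -/
def hemisphere (m : Sph d) : Set (Sph d) :=
  {x | sdist m x ≤ Real.pi / 2}

/-- The hemisphere `H(m)` supports `C`: it contains `C`, and the boundaries have a common point. -/
def Supports (m : Sph d) (C : Set (Sph d)) : Prop :=
  C ⊆ hemisphere m ∧ (frontier C ∩ frontier (hemisphere m)).Nonempty

/-- The part `bd H(g) ∩ H(h)` of the boundary of the lune `H(g) ∩ H(h)`; it is one of the two
`(d-1)`-dimensional hemispheres bounding the lune. -/
def luneFace (g h : Sph d) : Set (Sph d) :=
  frontier (hemisphere g) ∩ hemisphere h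

/-- `c` is the center of the `(d-1)`-dimensional hemisphere `bd H(g) ∩ H(h)`: `c` lies on the
great sphere `bd H(g)`, and the hemisphere consists of the points of that great sphere at
distance at most `π/2` from `c`. -/
def IsFaceCenter (g h c : Sph d) : Prop :=
  c ∈ frontier (hemisphere g) ∧
    luneFace g h = {x | x ∈ frontier (hemisphere g) ∧ sdist c x ≤ Real.pi / 2}

/-- `H(g)` and `H(h)` are different and not opposite, so that `H(g) ∩ H(h)` is a lune, and the
thickness of this lune, the distance of the centers of the two `(d-1)`-dimensional hemispheres
bounding it, is `t`. -/
def IsLuneThickness (g h : Sph d) (t : ℝ) : Prop :=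
  g ≠ h ∧ g ≠ -h ∧ ∃ c c' : Sph d, IsFaceCenter g h c ∧ IsFaceCenter h g c' ∧ t = sdist c c'

/-- The width of `C` determined by the hemisphere `H(k)` is `w`: this is the minimum of the
thicknesses of the lunes `H(k) ∩ H(m)`, over all hemispheres `H(m)` supporting `C`. -/
def IsWidth (k : Sph d) (C : Set (Sph d)) (w : ℝ) : Prop :=
  IsLeast {t | ∃ m : Sph d, Supports m C ∧ IsLuneThickness k m t} w

/-- `C` is of constant width `w`: its width determined by any supporting hemisphere is `w`. -/
def IsOfConstantWidth (C : Set (Sph d)) (w : ℝ) : Prop :=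
  ∀ k : Sph d, Supports k C → IsWidth k C w

/-- The diameter of `C` is `w`. -/
def IsDiameter (C : Set (Sph d)) (w : ℝ) : Prop :=
  IsLUB {r | ∃ p ∈ C, ∃ q ∈ C, r = sdist p q} w

/-- `C` is of constant diameter `w`: its diameter is `w`, and every boundary point of `C` is at
distance `w` from some point of `C`. -/
def IsOfConstantDiameter (C : Set (Sph d)) (w : ℝ) : Prop :=
  IsDiameter C w ∧ ∀ p ∈ frontier C, ∃ q ∈ C, sdist p q = w

end SphConvex

/-! ### Dual pairs of sets of unit vectors. -/

section DualPairs

open Metric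

variable {E : Type*} [NormedAddCommGroup E] [InnerProductSpace ℝ E]

local notation "⟪" x ", " y "⟫" => inner ℝ x y

/-! Let `A` be the body and `B` its dual, the set of centers of the hemispheres containing `A`. The
thickness of a lune is `π` minus the distance of the centers of its two hemispheres, so `A` has
constant width `w` exactly when `B` has constant diameter `π - w` (`isOfConstantWidth_iff`). What
remains is a statement on dual pairs: if `A` has constant diameter `δ`, then `B` has constant
diameter `π - δ` (`hasConstDiam_dual`). Duality is symmetric, so this applies to `(A, B)` and to
`(B, A)`, which gives both implications.

Distances are read as inner products, with `c = cos δ`; a boundary point of `A` is a vector of `A`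
orthogonal to some vector of `B`. The engine is completeness: a point close enough to all points of
a body lies in it. For `δ > π/2` it is the dual that is shown complete
(`mem_dual_of_forall_le_inner`), and a boundary point of `B` without a partner could be pushed out
of `B`. For `δ ≤ π/2` the set `A` is complete (`mem_of_forall_le_inner`), and a separation argument
puts into `A` the point at distance `δ` from a boundary point along its inner normal
(`normal_partner_mem`); this bounds the diameter of `B`, and partners in `B` are explicit. -/

lemma sq_inner_add_sq_inner_le_one {x k v : E} (hx : ‖x‖ = 1) (hk : ‖k‖ = 1)
    (hxk : ⟪x, k⟫ = 0) (hv : ‖v‖ = 1) : ⟪x, v⟫ ^ 2 + ⟪k, v⟫ ^ 2 ≤ 1 := by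
  -- Bessel's inequality: `y` is the projection of `v` to the plane of `x` and `k`, and `‖y‖ ^ 2 =
  -- ⟪y, v⟫ ≤ ‖y‖`.
  set y := ⟪x, v⟫ • x + ⟪k, v⟫ • k with hydef
  have hyn : ‖y‖ ^ 2 = ⟪x, v⟫ ^ 2 + ⟪k, v⟫ ^ 2 := by
    rw [hydef, norm_add_sq_real, norm_smul, norm_smul, real_inner_smul_left,
      real_inner_smul_right, hxk, hx, hk, Real.norm_eq_abs, Real.norm_eq_abs, mul_one, mul_one,
      sq_abs, sq_abs]; ring
  have hi : ⟪y, v⟫ = ⟪x, v⟫ ^ 2 + ⟪k, v⟫ ^ 2 := by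
    rw [hydef, inner_add_left, real_inner_smul_left, real_inner_smul_left]; ring
  have hle := real_inner_le_norm y v
  rw [hi, hv, mul_one] at hle
  nlinarith [norm_nonneg y]

/-- First variation: if `a` minimizes `⟪z, ·⟫` over a set of unit vectors that is closed under
normalized positive combinations with `a`, then `z - ⟪z, a⟫ a` is nonnegative on the set. -/
lemma inner_sub_smul_nonneg_of_minimizer {A : Set E} {a z : E} (hA1 : ∀ u ∈ A, ‖u‖ = 1)
    (ha : a ∈ A)
    (hA : ∀ u ∈ A, ∀ ε : ℝ, 0 < ε → a + ε • u ≠ 0 ∧ ‖a + ε • u‖⁻¹ • (a + ε • u) ∈ A)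
    (hmin : ∀ u ∈ A, ⟪z, a⟫ ≤ ⟪z, u⟫) {u : E} (hu : u ∈ A) :
    0 ≤ ⟪z - ⟪z, a⟫ • a, u⟫ := by
  rw [inner_sub_left, real_inner_smul_left]
  set c := ⟪z, a⟫ with hc
  refine le_of_forall_pos_le_add fun ε hε => ?_
  -- The norm of `a + η • u` is `1 + η * ⟪a, u⟫` up to `η ^ 2 / 2`, so minimality divided by `η`
  -- gives the claim with an error of at most `|c| * η`.
  obtain ⟨η, hη, hηε⟩ : ∃ η : ℝ, 0 < η ∧ |c| * η ≤ ε :=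
    ⟨ε / (|c| + 1), by positivity, by
      rw [mul_div_assoc', div_le_iff₀ (by positivity)]; nlinarith [abs_nonneg c]⟩
  obtain ⟨hne, hmem⟩ := hA u hu η hη
  have hpos : 0 < ‖a + η • u‖ := norm_pos_iff.2 hne
  have h1 := hmin _ hmem
  rw [real_inner_smul_right, inner_add_right, real_inner_smul_right, ← hc,
    ← div_eq_inv_mul, le_div_iff₀ hpos] at h1
  have hsq : ‖a + η • u‖ ^ 2 = 1 + 2 * (η * ⟪a, u⟫) + η ^ 2 := by
    rw [norm_add_sq_real, real_inner_smul_right, norm_smul, hA1 a ha, hA1 u hu,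
      Real.norm_eq_abs, abs_of_pos hη]; ring
  have hlow : 1 + η * ⟪a, u⟫ ≤ ‖a + η • u‖ := by
    have := real_inner_le_norm a (a + η • u)
    rwa [inner_add_right, real_inner_smul_right, real_inner_self_eq_norm_sq, hA1 a ha,
      one_mul, one_pow] at this
  have hupp : ‖a + η • u‖ ≤ 1 + η * ⟪a, u⟫ + η ^ 2 / 2 := by
    nlinarith [sq_nonneg (‖a + η • u‖ - 1)]
  have h2 : c * (η * ⟪a, u⟫) - |c| * (η ^ 2 / 2) ≤ η * ⟪z, u⟫ := by
    have h3 : -(|c| * (η ^ 2 / 2)) ≤ c * (‖a + η • u‖ - 1 - η * ⟪a, u⟫) := by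
      have h4 : |c * (‖a + η • u‖ - 1 - η * ⟪a, u⟫)| ≤ |c| * (η ^ 2 / 2) := by
        rw [abs_mul]
        exact mul_le_mul_of_nonneg_left (abs_le.2 ⟨by nlinarith [sq_nonneg η], by linarith⟩)
          (abs_nonneg c)
      exact (abs_le.1 h4).1
    nlinarith
  have h5 : 0 ≤ η * (⟪z, u⟫ - c * ⟪a, u⟫ + |c| * η) := by
    nlinarith [abs_nonneg c, mul_nonneg (abs_nonneg c) (sq_nonneg η)]
  have := nonneg_of_mul_nonneg_right h5 hη
  linarith

/-- Two sets of unit vectors that are the traces on the unit sphere of two mutually dual closed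
convex cones, both pointed and with interior points. -/
structure IsDualPair (A B : Set E) : Prop where
  norm_left : ∀ a ∈ A, ‖a‖ = 1
  norm_right : ∀ b ∈ B, ‖b‖ = 1
  mem_left : ∀ a, ‖a‖ = 1 → (∀ b ∈ B, 0 ≤ ⟪a, b⟫) → a ∈ A
  mem_right : ∀ b, ‖b‖ = 1 → (∀ a ∈ A, 0 ≤ ⟪b, a⟫) → b ∈ B
  nonneg : ∀ a ∈ A, ∀ b ∈ B, 0 ≤ ⟪a, b⟫
  exists_left : ∃ o ∈ A, ∀ b ∈ B, 0 < ⟪o, b⟫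
  exists_right : ∃ o ∈ B, ∀ a ∈ A, 0 < ⟪o, a⟫

/-- In a dual pair, the set `A` has diameter at most `arccos c`, and each of its boundary points
is at distance `arccos c` from some point of `A`. -/
def HasConstDiam (A B : Set E) (c : ℝ) : Prop :=
  (∀ a ∈ A, ∀ a' ∈ A, c ≤ ⟪a, a'⟫) ∧
    ∀ a ∈ A, ∀ b ∈ B, ⟪a, b⟫ = 0 → ∃ a' ∈ A, ⟪a, a'⟫ = c

namespace IsDualPair

variable {A B : Set E}

lemma symm (h : IsDualPair A B) : IsDualPair B A where
  norm_left := h.norm_right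
  norm_right := h.norm_left
  mem_left := h.mem_right
  mem_right := h.mem_left
  nonneg := fun b hb a ha => by rw [real_inner_comm]; exact h.nonneg a ha b hb
  exists_left := h.exists_right
  exists_right := h.exists_left

lemma normalize_mem (h : IsDualPair A B) {p : E} (hp : p ≠ 0) (hpB : ∀ b ∈ B, 0 ≤ ⟪p, b⟫) :
    ‖p‖⁻¹ • p ∈ A := by
  refine h.mem_left _ (norm_smul_inv_norm hp) fun b hb => ?_
  rw [real_inner_smul_left]
  exact mul_nonneg (by positivity) (hpB b hb)

lemma isClosed (h : IsDualPair A B) : IsClosed A := by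
  have : A = {a | ‖a‖ = 1} ∩ ⋂ b ∈ B, {a | 0 ≤ ⟪a, b⟫} := by
    ext a
    simp only [Set.mem_inter_iff, Set.mem_ofPred_eq, Set.mem_iInter]
    exact ⟨fun ha => ⟨h.norm_left a ha, h.nonneg a ha⟩, fun ha => h.mem_left a ha.1 ha.2⟩
  rw [this]
  refine (isClosed_eq continuous_norm continuous_const).inter ?_
  exact isClosed_biInter fun b _ => isClosed_le continuous_const (by fun_prop)

lemma isCompact [FiniteDimensional ℝ E] (h : IsDualPair A B) : IsCompact A := by
  have : ProperSpace E := FiniteDimensional.proper_real E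
  refine (isCompact_sphere (0 : E) 1).of_isClosed_subset h.isClosed fun a ha => ?_
  simpa using h.norm_left a ha

lemma inner_self_left (h : IsDualPair A B) {a : E} (ha : a ∈ A) : ⟪a, a⟫ = 1 := by
  rw [real_inner_self_eq_norm_sq, h.norm_left a ha, one_pow]

lemma inner_le_one (h : IsDualPair A B) {a a' : E} (ha : a ∈ A) (ha' : a' ∈ A) :
    ⟪a, a'⟫ ≤ 1 := by
  simpa [h.norm_left a ha, h.norm_left a' ha'] using real_inner_le_norm a a'

lemma neg_notMem (h : IsDualPair A B) {a : E} (ha : a ∈ A) : -a ∉ A := by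
  intro hna
  obtain ⟨o, -, ho⟩ := h.exists_right
  have h1 := ho a ha
  have h2 := ho _ hna
  rw [inner_neg_right] at h2
  linarith

lemma neg_one_lt_inner (h : IsDualPair A B) {a a' : E} (ha : a ∈ A) (ha' : a' ∈ A) :
    -1 < ⟪a, a'⟫ := by
  have h0 : |⟪a, a'⟫| ≤ 1 := by
    simpa [h.norm_left a ha, h.norm_left a' ha'] using abs_real_inner_le_norm a a'
  rcases (neg_le_of_abs_le h0).lt_or_eq with h1 | h1
  · exact h1
  · have := (inner_eq_neg_one_iff_of_norm_eq_one (𝕜 := ℝ)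
      (h.norm_left a ha) (h.norm_left a' ha')).1 h1.symm
    exact absurd (this ▸ ha) (h.neg_notMem ha')

lemma first_variation (h : IsDualPair A B) {a z : E} (ha : a ∈ A)
    (hmin : ∀ u ∈ A, ⟪z, a⟫ ≤ ⟪z, u⟫) {u : E} (hu : u ∈ A) :
    0 ≤ ⟪z - ⟪z, a⟫ • a, u⟫ := by
  refine inner_sub_smul_nonneg_of_minimizer h.norm_left ha (fun u hu ε hε => ?_) hmin hu
  have hne : a + ε • u ≠ 0 := by
    obtain ⟨o, -, ho⟩ := h.exists_right
    intro h0
    have h1 : ⟪o, a + ε • u⟫ = 0 := by rw [h0, inner_zero_right]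
    rw [inner_add_right, real_inner_smul_right] at h1
    have := ho a ha
    have := mul_pos hε (ho u hu)
    linarith
  refine ⟨hne, h.normalize_mem hne fun b hb => ?_⟩
  rw [inner_add_left, real_inner_smul_left]
  have := h.nonneg a ha b hb
  have := mul_nonneg hε.le (h.nonneg u hu b hb)
  linarith

/-- The point of `B` supporting `A` at a minimizer of the inner product with the unit vector
`z`. -/
lemma supporting_mem (h : IsDualPair A B) {a z : E} (ha : a ∈ A) (hz : ‖z‖ = 1)
    (hmin : ∀ u ∈ A, ⟪z, a⟫ ≤ ⟪z, u⟫) (h1 : -1 < ⟪z, a⟫) (h2 : ⟪z, a⟫ < 1) :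
    (√(1 - ⟪z, a⟫ ^ 2))⁻¹ • (z - ⟪z, a⟫ • a) ∈ B := by
  have hsq : ‖z - ⟪z, a⟫ • a‖ ^ 2 = 1 - ⟪z, a⟫ ^ 2 := by
    rw [norm_sub_sq_real, norm_smul, real_inner_smul_right, hz, h.norm_left a ha,
      Real.norm_eq_abs, mul_one, sq_abs]; ring
  have hn : √(1 - ⟪z, a⟫ ^ 2) = ‖z - ⟪z, a⟫ • a‖ := by
    rw [← hsq, Real.sqrt_sq (norm_nonneg _)]
  rw [hn]
  refine h.symm.normalize_mem (fun h0 => ?_) fun u hu => h.first_variation ha hmin hu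
  rw [h0, norm_zero] at hsq
  nlinarith

lemma inner_supporting (h : IsDualPair A B) {a z : E} (ha : a ∈ A) (r : ℝ) :
    ⟪a, r • (z - ⟪z, a⟫ • a)⟫ = 0 := by
  rw [real_inner_smul_right, inner_sub_right, real_inner_smul_right, h.inner_self_left ha,
    real_inner_comm]
  ring

lemma exists_minimizer [FiniteDimensional ℝ E] (h : IsDualPair A B) (z : E) :
    ∃ a ∈ A, ∀ u ∈ A, ⟪z, a⟫ ≤ ⟪z, u⟫ := by
  obtain ⟨o, ho, -⟩ := h.exists_left
  obtain ⟨a, ha, hmin⟩ := h.isCompact.exists_isMinOn ⟨o, ho⟩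
    (f := fun a => ⟪z, a⟫) (by fun_prop)
  exact ⟨a, ha, fun u hu => hmin hu⟩

/-- If the distance of points of `A` is bounded on the boundary of `A`, it is bounded on `A`. -/
lemma le_inner_of_boundary [FiniteDimensional ℝ E] (h : IsDualPair A B) {c : ℝ} (hc : c ≤ 1)
    (hbd : ∀ a ∈ A, ∀ a' ∈ A, ∀ b ∈ B, ∀ b' ∈ B, ⟪a, b⟫ = 0 → ⟪a', b'⟫ = 0 → a ≠ a' →
      (√(1 - ⟪a, a'⟫ ^ 2))⁻¹ • (a - ⟪a, a'⟫ • a') ∈ B → c ≤ ⟪a, a'⟫) :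
    ∀ a ∈ A, ∀ a' ∈ A, c ≤ ⟪a, a'⟫ := by
  obtain ⟨o, ho, -⟩ := h.exists_left
  -- In a farthest pair each point is farthest from the other, so both are boundary points.
  obtain ⟨⟨k, k'⟩, ⟨hk, hk'⟩, hmin⟩ := (h.isCompact.prod h.isCompact).exists_isMinOn
    ⟨(o, o), ho, ho⟩ (f := fun p : E × E => ⟪p.1, p.2⟫) (by fun_prop)
  simp only at hk hk'
  have hmin' : ∀ a ∈ A, ∀ a' ∈ A, ⟪k, k'⟫ ≤ ⟪a, a'⟫ := fun a ha a' ha' =>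
    hmin (show (a, a') ∈ A ×ˢ A from ⟨ha, ha'⟩)
  suffices c ≤ ⟪k, k'⟫ from fun a ha a' ha' => this.trans (hmin' a ha a' ha')
  by_cases hkk : k = k'
  · subst hkk
    rwa [h.inner_self_left hk]
  have hlt : ⟪k, k'⟫ < 1 := inner_lt_one_iff_real_of_norm_eq_one (h.norm_left k hk)
    (h.norm_left k' hk') |>.2 hkk
  have hgt := h.neg_one_lt_inner hk hk'
  have m1 := h.supporting_mem hk' (h.norm_left k hk) (fun u hu => hmin' k hk u hu) hgt hlt
  have m2 := h.supporting_mem hk (h.norm_left k' hk')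
    (fun u hu => by rw [real_inner_comm]; exact hmin' k' hk' u hu |>.trans_eq rfl)
    (by rwa [real_inner_comm]) (by rwa [real_inner_comm])
  exact hbd k hk k' hk' _ m2 _ m1 (h.inner_supporting hk _) (h.inner_supporting hk' _) hkk m1

/-- An interior point of `A` is at distance less than the diameter from every point of `A`. -/
lemma lt_inner_of_interior (h : IsDualPair A B) {c : ℝ} (hc1 : c < 1)
    (hd : ∀ a ∈ A, ∀ a' ∈ A, c ≤ ⟪a, a'⟫) {o : E} (ho : o ∈ A) (hoB : ∀ b ∈ B, 0 < ⟪o, b⟫)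
    {a : E} (ha : a ∈ A) : c < ⟪o, a⟫ := by
  -- Equality would make `o` a farthest point from `a`, hence orthogonal to a vector of `B`.
  refine (hd o ho a ha).lt_of_ne fun he => ?_
  have hao : ⟪a, o⟫ = c := by rw [real_inner_comm, he]
  have := h.supporting_mem ho (h.norm_left a ha) (fun u hu => hao.le.trans (hd a ha u hu))
    (h.neg_one_lt_inner ha ho) (by rwa [hao])
  exact (hoB _ this).ne' (h.inner_supporting ho _)

/-- The points supporting `A` at both ends of a diameter. -/
lemma diameter_supporting_mem (h : IsDualPair A B) {c : ℝ} (hc1 : c < 1)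
    (hd : ∀ a ∈ A, ∀ a' ∈ A, c ≤ ⟪a, a'⟫) {v q : E} (hv : v ∈ A) (hq : q ∈ A)
    (hvq : ⟪v, q⟫ = c) : (√(1 - c ^ 2))⁻¹ • (q - c • v) ∈ B := by
  have hqv : ⟪q, v⟫ = c := by rw [real_inner_comm, hvq]
  have := h.supporting_mem hv (h.norm_left q hq) (fun u hu => hqv.le.trans (hd q hq u hu))
    (h.neg_one_lt_inner hq hv) (by rwa [hqv])
  rwa [hqv] at this

/-! ### Constant diameter greater than `π/2`. -/

section Obtuse

variable [FiniteDimensional ℝ E]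

/-- If `A` has constant diameter greater than `π/2`, then the dual set is complete. -/
lemma mem_dual_of_forall_le_inner (h : IsDualPair A B) {c : ℝ} (hc : c < 0)
    (hA : HasConstDiam A B c) {z : E} (hz : ‖z‖ = 1) (hzB : ∀ b ∈ B, -c ≤ ⟪z, b⟫) : z ∈ B := by
  obtain ⟨v, hv, hmin⟩ := h.exists_minimizer z
  rcases le_or_gt 0 ⟪z, v⟫ with h0 | h0
  · exact h.mem_right z hz fun a ha => h0.trans (hmin a ha)
  exfalso
  have hzv : -1 < ⟪z, v⟫ := by
    have h0 : |⟪z, v⟫| ≤ 1 := by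
      simpa [hz, h.norm_left v hv] using abs_real_inner_le_norm z v
    refine (neg_le_of_abs_le h0).lt_of_ne fun he => ?_
    have hzv := (inner_eq_neg_one_iff_of_norm_eq_one (𝕜 := ℝ) hz (h.norm_left v hv)).1 he.symm
    obtain ⟨b, hb, -⟩ := h.exists_right
    have h1 := hzB b hb
    rw [hzv, inner_neg_left] at h1
    have := h.nonneg v hv b hb
    linarith
  have hb := h.supporting_mem hv hz hmin hzv (h0.trans one_pos)
  obtain ⟨q, hq, hvq⟩ := hA.2 v hv _ hb (h.inner_supporting hv _)
  have hcgt : -1 < c := hvq ▸ h.neg_one_lt_inner hv hq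
  have hc1 : c < 1 := by linarith
  have hn := h.diameter_supporting_mem hc1 hA.1 hv hq hvq
  have hn2 := h.diameter_supporting_mem hc1 hA.1 hq hv (by rwa [real_inner_comm])
  set s := √(1 - c ^ 2) with hs
  have hs0 : 0 < s := Real.sqrt_pos.2 (by nlinarith)
  have hs2 : s ^ 2 = 1 - c ^ 2 := Real.sq_sqrt (by nlinarith)
  -- The normal at `q` is `s • v` minus `c` times the normal at `v`. As `⟪z, v⟫ < 0`, its inner
  -- product with `z` is below `-c`.
  have e : ⟪z, s⁻¹ • (v - c • q)⟫ = s * ⟪z, v⟫ - c * ⟪z, s⁻¹ • (q - c • v)⟫ := by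
    simp only [real_inner_smul_right, inner_sub_right]
    field_simp
    rw [hs2]; ring
  have h1 := hzB _ hn2
  have h2 : ⟪z, s⁻¹ • (q - c • v)⟫ ≤ 1 := by
    simpa [hz, h.norm_right _ hn] using real_inner_le_norm z (s⁻¹ • (q - c • v))
  rw [e] at h1
  nlinarith [mul_pos hs0 (neg_pos.2 h0)]

/-- The plane of a farthest pair of `B` contains a boundary point of `A`, whose partner keeps the
pair from being too far apart. A boundary point of `B` without a partner could be moved outward,
against the completeness of `B`. -/
lemma hasConstDiam_dual_of_neg (h : IsDualPair A B) {c : ℝ} (hc1 : -1 < c) (hc : c < 0)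
    (hA : HasConstDiam A B c) : HasConstDiam B A (-c) := by
  have hdiam : ∀ b ∈ B, ∀ b' ∈ B, -c ≤ ⟪b, b'⟫ := by
    refine h.symm.le_inner_of_boundary (by linarith) fun k hk k' hk' _ _ _ _ _ _ hkk hx => ?_
    by_contra! hlt
    set t := ⟪k, k'⟫ with ht
    have htgt : -1 < t := h.symm.neg_one_lt_inner hk hk'
    set s := √(1 - t ^ 2) with hs
    have hs0 : 0 < s := Real.sqrt_pos.2 (by nlinarith)
    have hs2 : s ^ 2 = 1 - t ^ 2 := Real.sq_sqrt (by nlinarith)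
    set x := s⁻¹ • (k - t • k') with hxdef
    have hxk' : ⟪x, k'⟫ = 0 := by
      rw [real_inner_comm]; exact h.symm.inner_supporting hk' _
    obtain ⟨q, hq, hxq⟩ := hA.2 x hx k' hk' hxk'
    have hkx : k = t • k' + s • x := by
      rw [hxdef, smul_inv_smul₀ hs0.ne']; abel
    have h0 := h.nonneg q hq k hk
    have h1 := h.nonneg q hq k' hk'
    rw [hkx, inner_add_right, real_inner_smul_right, real_inner_smul_right,
      real_inner_comm x q, hxq] at h0
    -- Now `s * -c ≤ t * ⟪q, k'⟫`, while Bessel gives `⟪q, k'⟫ ^ 2 ≤ 1 - c ^ 2`; together they force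
    -- `t ≥ -c`.
    have hsq := sq_inner_add_sq_inner_le_one (h.norm_left x hx) (h.norm_right k' hk') hxk'
      (h.norm_left q hq)
    rw [hxq, real_inner_comm q k'] at hsq
    have hsc : 0 < s * -c := mul_pos hs0 (by linarith)
    rcases le_or_gt t 0 with ht0 | ht0
    · nlinarith [mul_nonneg (neg_nonneg.2 ht0) h1]
    · have h3 : s * -c ≤ t * ⟪q, k'⟫ := by linarith
      have h4 : (s * -c) ^ 2 ≤ (t * ⟪q, k'⟫) ^ 2 := by gcongr
      rw [mul_pow, mul_pow, hs2] at h4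
      nlinarith [mul_le_mul_of_nonneg_left hsq (sq_nonneg t)]
  refine ⟨hdiam, fun k hk x hx hkx => ?_⟩
  by_contra! hne
  obtain ⟨m, hm, hmin⟩ := h.symm.exists_minimizer k
  have hlt : -c < ⟪k, m⟫ := (hdiam k hk m hm).lt_of_ne (hne m hm).symm
  -- Half of the slack: replacing `k` by `k - ε • x` costs at most `ε` in the inner products and at
  -- most `ε` more through the norm.
  set ε := (⟪k, m⟫ + c) / 2 with hε
  have hε0 : 0 < ε := by rw [hε]; linarith
  have hsq : ‖k - ε • x‖ ^ 2 = 1 + ε ^ 2 := by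
    rw [norm_sub_sq_real, norm_smul, real_inner_smul_right, hkx, h.norm_right k hk,
      h.norm_left x hx, Real.norm_eq_abs, mul_one, sq_abs]; ring
  have hle : ‖k - ε • x‖ ≤ 1 + ε := by nlinarith [norm_nonneg (k - ε • x)]
  have hpos : 0 < ‖k - ε • x‖ := by
    refine (norm_nonneg _).lt_of_ne fun he => ?_
    rw [← he] at hsq
    nlinarith
  have hmem := h.mem_dual_of_forall_le_inner hc hA
    (norm_smul_inv_norm (𝕜 := ℝ) (norm_pos_iff.1 hpos)) fun b hb => by
      rw [real_inner_smul_left, inner_sub_left, real_inner_smul_left]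
      simp only [RCLike.ofReal_real_eq_id, id_eq]
      rw [← div_eq_inv_mul, le_div_iff₀ hpos]
      have h1 := hmin b hb
      have h2 : ⟪x, b⟫ ≤ 1 := by
        simpa [h.norm_left x hx, h.norm_right b hb] using real_inner_le_norm x b
      nlinarith [mul_le_mul_of_nonneg_left hle (neg_nonneg.2 hc.le)]
  have h1 := h.nonneg x hx _ hmem
  rw [real_inner_smul_right, inner_sub_right, real_inner_smul_right, real_inner_comm, hkx,
    h.inner_self_left hx] at h1
  simp only [RCLike.ofReal_real_eq_id, id_eq] at h1
  have := nonneg_of_mul_nonneg_right h1 (inv_pos.2 hpos)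
  linarith

end Obtuse

/-! ### Constant diameter at most `π/2`. -/

section Acute

variable [FiniteDimensional ℝ E]

/-- A set of constant diameter at most `π/2` is complete. -/
lemma mem_of_forall_le_inner (h : IsDualPair A B) {c : ℝ} (hc : 0 ≤ c) (hc1 : c < 1)
    (hA : HasConstDiam A B c) {z : E} (hz : ‖z‖ = 1) (hzA : ∀ a ∈ A, c ≤ ⟪z, a⟫) : z ∈ A := by
  by_contra hzn
  obtain ⟨o, ho, hoB⟩ := h.exists_left
  obtain ⟨b₁, hb₁, hzb₁⟩ : ∃ b ∈ B, ⟪z, b⟫ < 0 := by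
    by_contra! hcon
    exact hzn (h.mem_left z hz hcon)
  obtain ⟨b₀, hb₀, hmin⟩ := h.symm.isCompact.exists_isMinOn ⟨b₁, hb₁⟩
    (f := fun b => ⟪z, b⟫ / ⟪o, b⟫)
    (ContinuousOn.div (by fun_prop) (by fun_prop) fun b hb => (hoB b hb).ne')
  -- With this `μ`, the ray from `z` in direction `o` enters the cone over `A` at `z + μ • o`, on
  -- the face orthogonal to `b₀`.
  set μ := -(⟪z, b₀⟫ / ⟪o, b₀⟫) with hμ
  have hμ0 : 0 < μ := by
    have h1 : ⟪z, b₀⟫ / ⟪o, b₀⟫ ≤ ⟪z, b₁⟫ / ⟪o, b₁⟫ := hmin hb₁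
    have := div_neg_of_neg_of_pos hzb₁ (hoB b₁ hb₁)
    rw [hμ]; linarith
  have hpB : ∀ b ∈ B, 0 ≤ ⟪z + μ • o, b⟫ := by
    intro b hb
    have h1 : ⟪z, b₀⟫ / ⟪o, b₀⟫ ≤ ⟪z, b⟫ / ⟪o, b⟫ := hmin hb
    rw [le_div_iff₀ (hoB b hb)] at h1
    rw [inner_add_left, real_inner_smul_left, hμ]
    linarith
  have hp0 : ⟪z + μ • o, b₀⟫ = 0 := by
    have := (hoB b₀ hb₀).ne'
    rw [inner_add_left, real_inner_smul_left, hμ]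
    field_simp
    ring
  -- The strict inequality comes from `o`; it leaves the boundary point just found without a
  -- partner.
  have hlt : ∀ a ∈ A, c * (1 + μ) < ⟪z + μ • o, a⟫ := fun a ha => by
    have h1 := hzA a ha
    have h2 := h.lt_inner_of_interior hc1 hA.1 ho hoB ha
    rw [inner_add_left, real_inner_smul_left]
    nlinarith
  have hpne : z + μ • o ≠ 0 := fun h0 => by
    have := hlt o ho
    rw [h0, inner_zero_left] at this
    nlinarith
  have hpos : 0 < ‖z + μ • o‖ := norm_pos_iff.2 hpne
  have hnle : ‖z + μ • o‖ ≤ 1 + μ := by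
    refine (norm_add_le _ _).trans_eq ?_
    rw [norm_smul, hz, h.norm_left o ho, Real.norm_eq_abs, abs_of_pos hμ0, mul_one]
  obtain ⟨q, hq, hpq⟩ := hA.2 _ (h.normalize_mem hpne hpB) b₀ hb₀
    (by rw [real_inner_smul_left, hp0, mul_zero])
  rw [real_inner_smul_left, ← div_eq_inv_mul, div_eq_iff hpos.ne'] at hpq
  have := hlt q hq
  nlinarith [mul_le_mul_of_nonneg_left hnle hc]

/-- For a set of constant diameter at most `π/2`, no direction that leaves the set at the
boundary point `x` makes acute angles with all diametral partners of `x`. -/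
lemma inner_nonneg_of_inner_partner_pos (h : IsDualPair A B) {c : ℝ} (hc : 0 ≤ c) (hc1 : c < 1)
    (hA : HasConstDiam A B c) {x k t : E} (hx : x ∈ A) (hk : k ∈ B) (hxk : ⟪x, k⟫ = 0)
    (htx : ⟪x, t⟫ = 0) (ht : ∀ q ∈ A, ⟪x, q⟫ = c → 0 < ⟪t, q⟫) : 0 ≤ ⟪t, k⟫ := by
  by_contra! htk
  -- By compactness, every `v` either has a uniform margin over the bound `c` or comes closer at a
  -- uniform rate as `x` moves along `t`.
  obtain ⟨η, hη, hηt⟩ : ∃ η > 0, ∀ v ∈ A, c + η ≤ ⟪x, v⟫ ∨ η ≤ ⟪t, v⟫ := by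
    obtain ⟨v₀, hv₀, hmin⟩ := h.isCompact.exists_isMinOn ⟨x, hx⟩
      (f := fun v => max (⟪x, v⟫ - c) ⟪t, v⟫) (by fun_prop)
    refine ⟨max (⟪x, v₀⟫ - c) ⟪t, v₀⟫, ?_, fun v hv => ?_⟩
    · rcases (hA.1 x hx v₀ hv₀).lt_or_eq with h1 | h1
      · exact lt_max_of_lt_left (by linarith)
      · exact lt_max_of_lt_right (ht v₀ hv₀ h1.symm)
    · have h1 : max (⟪x, v₀⟫ - c) ⟪t, v₀⟫ ≤ max (⟪x, v⟫ - c) ⟪t, v⟫ := hmin hv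
      rcases le_max_iff.1 h1 with h2 | h2
      · left; linarith
      · right; exact h2
  set T := ‖t‖ with hT
  have hT0 : 0 ≤ T := norm_nonneg t
  -- Normalizing `x + ε • t` costs only the second order term `ε ^ 2 * T ^ 2`; where the margin is
  -- used, the motion costs at most `ε * T`.
  obtain ⟨ε, hε, hε1, hε2⟩ : ∃ ε : ℝ, 0 < ε ∧ ε * T ^ 2 ≤ η ∧ ε * (T + T ^ 2 + 1) ≤ η ∧
      ε ≤ 1 := by
    refine ⟨min 1 (η / (T + T ^ 2 + 1)), by positivity, ?_, ?_, min_le_left _ _⟩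
    · have h1 : min 1 (η / (T + T ^ 2 + 1)) * (T + T ^ 2 + 1) ≤ η := by
        rw [← le_div_iff₀ (by positivity)]; exact min_le_right _ _
      have h2 : 0 ≤ min 1 (η / (T + T ^ 2 + 1)) := by positivity
      nlinarith [mul_nonneg h2 hT0]
    · rw [← le_div_iff₀ (by positivity)]; exact min_le_right _ _
  set p := x + ε • t with hp
  have hpk : ⟪p, k⟫ < 0 := by
    rw [hp, inner_add_left, real_inner_smul_left, hxk, zero_add]
    exact mul_neg_of_pos_of_neg hε htk
  have hpne : p ≠ 0 := fun h0 => by rw [h0, inner_zero_left] at hpk; exact hpk.false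
  have hpos : 0 < ‖p‖ := norm_pos_iff.2 hpne
  have hsq : ‖p‖ ^ 2 = 1 + ε ^ 2 * T ^ 2 := by
    rw [hp, norm_add_sq_real, real_inner_smul_right, htx, norm_smul, h.norm_left x hx,
      Real.norm_eq_abs, abs_of_pos hε]; ring
  have hle : ‖p‖ ≤ 1 + ε ^ 2 * T ^ 2 := by nlinarith [mul_nonneg (sq_nonneg ε) (sq_nonneg T)]
  have hmem : ‖p‖⁻¹ • p ∈ A := by
    refine h.mem_of_forall_le_inner hc hc1 hA (norm_smul_inv_norm (𝕜 := ℝ) hpne) fun v hv => ?_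
    rw [real_inner_smul_left, ← div_eq_inv_mul, le_div_iff₀ hpos]
    refine (mul_le_mul_of_nonneg_left hle hc).trans ?_
    rw [hp, inner_add_left, real_inner_smul_left]
    have h1 : c * (ε ^ 2 * T ^ 2) ≤ ε * (ε * T ^ 2) := by
      nlinarith [mul_nonneg (sq_nonneg ε) (sq_nonneg T)]
    have h2 : ε * (ε * T ^ 2) ≤ ε * η := by gcongr
    rcases hηt v hv with h3 | h3
    · have h4 : -T ≤ ⟪t, v⟫ := by
        refine neg_le_of_abs_le ?_
        simpa [h.norm_left v hv] using abs_real_inner_le_norm t v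
      have h5 : ε * -T ≤ ε * ⟪t, v⟫ := by gcongr
      have h6 : ε * (ε * T ^ 2) ≤ ε * T ^ 2 := by
        gcongr
        nlinarith [sq_nonneg T, hε2.2]
      nlinarith [hε2.1]
    · have h4 : ε * η ≤ ε * ⟪t, v⟫ := by gcongr
      have := hA.1 x hx v hv
      linarith
  have h1 := h.nonneg _ hmem k hk
  rw [real_inner_smul_left] at h1
  have := nonneg_of_mul_nonneg_right h1 (inv_pos.2 hpos)
  linarith

/-- For a set of constant diameter at most `π/2`, the inner normal at each boundary point leads
to a diametral partner. -/
lemma normal_partner_mem (h : IsDualPair A B) {c : ℝ} (hc : 0 ≤ c) (hc1 : c < 1)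
    (hA : HasConstDiam A B c) {x k : E} (hx : x ∈ A) (hk : k ∈ B) (hxk : ⟪x, k⟫ = 0) :
    c • x + √(1 - c ^ 2) • k ∈ A := by
  set s := √(1 - c ^ 2) with hs
  have hs0 : 0 < s := Real.sqrt_pos.2 (by nlinarith)
  have hs2 : s ^ 2 = 1 - c ^ 2 := Real.sq_sqrt (by nlinarith)
  -- `Q` holds the components orthogonal to `x` of its partners, all of norm `s`. The goal is a
  -- multiple `r • k` in the closed convex hull `T`; otherwise a separating vector contradicts the
  -- preceding lemma.
  set Q := (fun q => q - c • x) '' {q ∈ A | ⟪x, q⟫ = c} with hQ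
  set T := closure (convexHull ℝ Q) with hTdef
  have hTsub : ∀ S : Set E, Convex ℝ S → IsClosed S → Q ⊆ S → T ⊆ S := fun S hS hS' hQS =>
    closure_minimal (convexHull_min hQS hS) hS'
  have hTball : T ⊆ closedBall 0 s := by
    refine hTsub _ (convex_closedBall _ _) isClosed_closedBall ?_
    rintro _ ⟨q, ⟨hq, hxq⟩, rfl⟩
    have h1 : ‖q - c • x‖ ^ 2 = s ^ 2 := by
      rw [norm_sub_sq_real, real_inner_smul_right, real_inner_comm, hxq, norm_smul,
        h.norm_left q hq, h.norm_left x hx, Real.norm_eq_abs, mul_one, sq_abs, hs2]; ring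
    simpa using (sq_le_sq₀ (norm_nonneg _) hs0.le).1 h1.le
  have hThalf : ∀ (v : E) (r : ℝ), (∀ q ∈ A, ⟪x, q⟫ = c → r ≤ ⟪v, q - c • x⟫) →
      ∀ τ ∈ T, r ≤ ⟪v, τ⟫ := by
    intro v r hv
    refine hTsub {τ | r ≤ ⟪v, τ⟫} ?_ (isClosed_le continuous_const (by fun_prop)) ?_
    · exact convex_halfSpace_ge (innerₗ E v).isLinear r
    · rintro _ ⟨q, ⟨hq, hxq⟩, rfl⟩
      exact hv q hq hxq
  by_cases hdis : Disjoint T ((fun r : ℝ => r • k) '' Set.Ici 0)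
  · have hTc : IsCompact T := by
      have : ProperSpace E := FiniteDimensional.proper_real E
      exact isCompact_of_isClosed_isBounded isClosed_closure (isBounded_closedBall.subset hTball)
    have hkn := h.norm_right k hk
    have hray : IsClosed ((fun r : ℝ => r • k) '' Set.Ici 0) := by
      refine (Isometry.isClosedEmbedding ?_).isClosedMap _ isClosed_Ici
      refine Isometry.of_dist_eq fun r r' => ?_
      rw [dist_eq_norm, ← sub_smul, norm_smul, hkn, mul_one, Real.dist_eq, Real.norm_eq_abs]
    have hrayc : Convex ℝ ((fun r : ℝ => r • k) '' Set.Ici 0) :=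
      (convex_Ici (𝕜 := ℝ) (0 : ℝ)).is_linear_image (LinearMap.toSpanSingleton ℝ E k).isLinear
    obtain ⟨f, u, hfr, hfT⟩ : ∃ (f : StrongDual ℝ E) (u : ℝ), (∀ r : ℝ, 0 ≤ r → f (r • k) < u) ∧
        ∀ τ ∈ T, u < f τ := by
      obtain ⟨f, u, v, h1, h2, h3⟩ :=
        geometric_hahn_banach_closed_compact hrayc hray (convex_convexHull ℝ Q).closure hTc hdis.symm
      exact ⟨f, u, fun r hr => h1 _ ⟨r, hr, rfl⟩, fun τ hτ => h2.trans (h3 τ hτ)⟩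
    set t := (InnerProductSpace.toDual ℝ E).symm f with ht
    have hft : ∀ y, f y = ⟪t, y⟫ := fun y => by rw [ht, InnerProductSpace.toDual_symm_apply]
    have hu : 0 < u := by simpa using hfr 0 le_rfl
    have htk : ⟪t, k⟫ ≤ 0 := by
      by_contra! hpos
      have h1 := hfr (u / ⟪t, k⟫) (by positivity)
      rw [hft, real_inner_smul_right, div_mul_cancel₀ _ hpos.ne'] at h1
      exact h1.false
    -- Dropping the `x`-component makes `t` tangent; subtracting `ε • k` makes its inner product
    -- with `k` negative and keeps those with the partners above `u - ε > 0`.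
    set ε := u / 2 with hε
    have hxx := h.inner_self_left hx
    have hkk := h.symm.inner_self_left hk
    have := h.inner_nonneg_of_inner_partner_pos hc hc1 hA (t := t - ⟪x, t⟫ • x - ε • k)
      hx hk hxk ?_ ?_
    · rw [inner_sub_left, inner_sub_left, real_inner_smul_left, real_inner_smul_left, hxk,
        hkk] at this
      linarith
    · rw [inner_sub_right, inner_sub_right, real_inner_smul_right, real_inner_smul_right, hxk,
        hxx]; ring
    · intro q hq hxq
      have h1 := hfT _ (subset_closure (subset_convexHull ℝ _ ⟨q, ⟨hq, hxq⟩, rfl⟩))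
      rw [hft, inner_sub_right, real_inner_smul_right] at h1
      rw [inner_sub_left, inner_sub_left, real_inner_smul_left, real_inner_smul_left, hxq]
      have h2 : ⟪k, q⟫ ≤ 1 := by
        simpa [hkn, h.norm_left q hq] using real_inner_le_norm k q
      have h3 := real_inner_comm t x
      nlinarith
  · obtain ⟨_, hτ, r, hr, rfl⟩ := Set.not_disjoint_iff.1 hdis
    simp only at hτ
    have hr0 : 0 ≤ r := hr
    have hrs : r ≤ s := by
      have := hTball hτ
      rwa [mem_closedBall_zero_iff, norm_smul, h.norm_right k hk, mul_one, Real.norm_eq_abs,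
        abs_of_nonneg hr0] at this
    have hrpos : 0 < r := by
      refine hr0.lt_of_ne fun h0 => ?_
      obtain ⟨o, ho, hoB⟩ := h.exists_left
      obtain ⟨a, ha, hmin⟩ := h.exists_minimizer o
      have h1 := h.lt_inner_of_interior hc1 hA.1 ho hoB ha
      have h2 := hThalf o (⟪o, a⟫ - c) (fun q hq hxq => by
        rw [inner_sub_right, real_inner_smul_right]
        have := hmin q hq
        nlinarith [h.inner_le_one ho hx]) _ hτ
      rw [← h0, zero_smul, inner_zero_right] at h2
      linarith
    refine h.mem_of_forall_le_inner hc hc1 hA ?_ fun v hv => ?_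
    · have : ‖c • x + s • k‖ ^ 2 = 1 := by
        rw [norm_add_sq_real, norm_smul, norm_smul, real_inner_smul_left, real_inner_smul_right,
          hxk, h.norm_left x hx, h.norm_right k hk, Real.norm_eq_abs, Real.norm_eq_abs, mul_one,
          mul_one, sq_abs, sq_abs, hs2]; ring
      exact (pow_eq_one_iff_of_nonneg (norm_nonneg _) two_ne_zero).1 this
    -- The bound `c ≤ ⟪v, q⟫` is linear in `q`, so it passes to `r • k` in the hull; since `⟪v, k⟫ ≥
    -- 0`, `r` may be raised to `s`.
    · have h1 := hThalf v (c - c * ⟪x, v⟫) (fun q hq hxq => by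
        rw [inner_sub_right, real_inner_smul_right, real_inner_comm x v]
        have := hA.1 v hv q hq
        linarith) _ hτ
      rw [real_inner_smul_right] at h1
      rw [inner_add_left, real_inner_smul_left, real_inner_smul_left, real_inner_comm v k]
      have h2 := h.nonneg v hv k hk
      nlinarith [mul_le_mul_of_nonneg_right hrs h2]

/-- All happens in the plane of `x` and `k`: the point `c • x + s • k` of `A` bounds `⟪k, k'⟫` from
below, and the unit vector `s • x - c • k` orthogonal to it is the partner of `k`. -/
lemma hasConstDiam_dual_of_nonneg (h : IsDualPair A B) {c : ℝ} (hc : 0 ≤ c) (hc1 : c < 1)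
    (hA : HasConstDiam A B c) : HasConstDiam B A (-c) := by
  set s := √(1 - c ^ 2) with hs
  have hs0 : 0 < s := Real.sqrt_pos.2 (by nlinarith)
  have hs2 : s ^ 2 = 1 - c ^ 2 := Real.sq_sqrt (by nlinarith)
  constructor
  · refine h.symm.le_inner_of_boundary (by linarith)
      fun k hk k' hk' x hx _ _ hkx _ _ _ => ?_
    have hy := h.normal_partner_mem hc hc1 hA hx hk (by rwa [real_inner_comm])
    have h1 := h.nonneg _ hy k' hk'
    have h2 := h.nonneg x hx k' hk'
    rw [inner_add_left, real_inner_smul_left, real_inner_smul_left] at h1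
    by_contra! hlt
    have hsq := sq_inner_add_sq_inner_le_one (h.norm_left x hx) (h.norm_right k hk)
      (by rwa [real_inner_comm]) (h.norm_right k' hk')
    have h3 : s * -⟪k, k'⟫ ≤ c * ⟪x, k'⟫ := by linarith
    have h4 : (s * -⟪k, k'⟫) ^ 2 ≤ (c * ⟪x, k'⟫) ^ 2 := by
      have : 0 ≤ -⟪k, k'⟫ := by linarith
      gcongr
    rw [mul_pow, mul_pow, hs2] at h4
    nlinarith [mul_le_mul_of_nonneg_left hsq (sq_nonneg c)]
  · intro k hk x hx hkx
    refine ⟨s • x - c • k, h.mem_right _ ?_ fun v hv => ?_, ?_⟩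
    · have : ‖s • x - c • k‖ ^ 2 = 1 := by
        rw [norm_sub_sq_real, norm_smul, norm_smul, real_inner_smul_left, real_inner_smul_right,
          real_inner_comm k x, hkx, h.norm_left x hx, h.norm_right k hk, Real.norm_eq_abs,
          Real.norm_eq_abs, mul_one, mul_one, sq_abs, sq_abs, hs2]; ring
      exact (pow_eq_one_iff_of_nonneg (norm_nonneg _) two_ne_zero).1 this
    · have h1 := hA.1 x hx v hv
      have h2 := h.nonneg v hv k hk
      rw [real_inner_comm] at h2
      rw [inner_sub_left, real_inner_smul_left, real_inner_smul_left, sub_nonneg]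
      have hsq := sq_inner_add_sq_inner_le_one (h.norm_left x hx) (h.norm_right k hk)
        (by rwa [real_inner_comm]) (h.norm_left v hv)
      refine (sq_le_sq₀ (mul_nonneg hc h2) (mul_nonneg hs0.le (hc.trans h1))).1 ?_
      rw [mul_pow, mul_pow, hs2]
      nlinarith [mul_le_mul_of_nonneg_left hsq (sq_nonneg c), mul_self_le_mul_self hc h1]
    · rw [inner_sub_right, real_inner_smul_right, real_inner_smul_right, hkx,
        h.symm.inner_self_left hk]; ring

end Acute

/-- The dual of a set of constant diameter `δ` has constant diameter `π - δ`. -/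
theorem hasConstDiam_dual [FiniteDimensional ℝ E] (h : IsDualPair A B) {c : ℝ} (hc : -1 < c) (hc1 : c < 1)
    (hA : HasConstDiam A B c) : HasConstDiam B A (-c) := by
  rcases lt_or_ge c 0 with h0 | h0
  · exact h.hasConstDiam_dual_of_neg hc h0 hA
  · exact h.hasConstDiam_dual_of_nonneg h0 hc1 hA

end IsDualPair

end DualPairs

/-! ### Distances, hemispheres and lunes on the sphere. -/

namespace SphConvex

variable {d : ℕ}

local notation "⟪" x ", " y "⟫" => inner ℝ x y

lemma norm_coe (a : Sph d) : ‖(a : EuclideanSpace ℝ (Fin (d + 1)))‖ = 1 := by simp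

lemma inner_coe_self (a : Sph d) : ⟪a.1, a.1⟫ = 1 := by
  rw [real_inner_self_eq_norm_sq, norm_coe, one_pow]

lemma sdist_eq_arccos (a b : Sph d) : sdist a b = Real.arccos ⟪a.1, b.1⟫ := by
  rw [sdist, InnerProductGeometry.angle, norm_coe, norm_coe, mul_one, div_one]

lemma abs_inner_le_one (a b : Sph d) : |⟪a.1, b.1⟫| ≤ 1 := by
  simpa using abs_real_inner_le_norm a.1 b.1

lemma cos_sdist (a b : Sph d) : Real.cos (sdist a b) = ⟪a.1, b.1⟫ := by
  have h := abs_le.1 (abs_inner_le_one a b)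
  rw [sdist_eq_arccos, Real.cos_arccos h.1 h.2]

lemma sdist_mem_Icc (a b : Sph d) : sdist a b ∈ Set.Icc 0 Real.pi :=
  ⟨InnerProductGeometry.angle_nonneg _ _, InnerProductGeometry.angle_le_pi _ _⟩

lemma sdist_le_iff {w : ℝ} (hw : w ∈ Set.Icc 0 Real.pi) (a b : Sph d) :
    sdist a b ≤ w ↔ Real.cos w ≤ ⟪a.1, b.1⟫ := by
  rw [← cos_sdist]
  exact (Real.strictAntiOn_cos.le_iff_ge hw (sdist_mem_Icc a b)).symm

lemma sdist_eq_iff {w : ℝ} (hw : w ∈ Set.Icc 0 Real.pi) (a b : Sph d) :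
    sdist a b = w ↔ ⟪a.1, b.1⟫ = Real.cos w := by
  rw [← cos_sdist]
  exact (Real.injOn_cos.eq_iff (sdist_mem_Icc a b) hw).symm

lemma inner_eq_one_iff (a b : Sph d) : ⟪a.1, b.1⟫ = 1 ↔ a = b := by
  rw [inner_eq_one_iff_of_norm_eq_one (𝕜 := ℝ) (norm_coe a) (norm_coe b), Subtype.ext_iff]

lemma inner_eq_neg_one_iff (a b : Sph d) : ⟪a.1, b.1⟫ = -1 ↔ a = -b := by
  rw [inner_eq_neg_one_iff_of_norm_eq_one (𝕜 := ℝ) (norm_coe a) (norm_coe b), Subtype.ext_iff]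
  simp

lemma inner_mem_Ioo {a b : Sph d} (h1 : a ≠ b) (h2 : a ≠ -b) : ⟪a.1, b.1⟫ ∈ Set.Ioo (-1) 1 := by
  have h := abs_le.1 (abs_inner_le_one a b)
  exact ⟨h.1.lt_of_ne fun he => h2 ((inner_eq_neg_one_iff a b).1 he.symm),
    h.2.lt_of_ne fun he => h1 ((inner_eq_one_iff a b).1 he)⟩

/-- The radial projection of a nonzero vector to the sphere. -/
noncomputable def proj (p : EuclideanSpace ℝ (Fin (d + 1))) (hp : p ≠ 0) : Sph d :=
  ⟨‖p‖⁻¹ • p, by simpa using norm_smul_inv_norm (𝕜 := ℝ) hp⟩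

lemma mem_hemisphere {m x : Sph d} : x ∈ hemisphere m ↔ 0 ≤ ⟪m.1, x.1⟫ := by
  change sdist m x ≤ Real.pi / 2 ↔ _
  rw [sdist_eq_arccos, Real.arccos_le_pi_div_two]

/-- From an interior point of `S` one can move within `S` out of any hemisphere having the point
on its boundary. -/
lemma exists_inner_neg_of_mem_interior {S : Set (Sph d)} {x m : Sph d} (hx : x ∈ interior S)
    (hmx : ⟪m.1, x.1⟫ = 0) : ∃ y ∈ S, ⟪m.1, y.1⟫ < 0 := by
  have hnorm : ∀ ε : ℝ, ‖x.1 - ε • m.1‖ ^ 2 = 1 + ε ^ 2 := fun ε => by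
    rw [norm_sub_sq_real, norm_smul, real_inner_smul_right, real_inner_comm, hmx, norm_coe,
      norm_coe, Real.norm_eq_abs, mul_one, sq_abs]; ring
  have hne : ∀ ε : ℝ, x.1 - ε • m.1 ≠ 0 := fun ε h0 => by
    have := hnorm ε
    rw [h0, norm_zero] at this
    nlinarith
  have hcont : Continuous fun ε : ℝ => proj _ (hne ε) := by
    refine Continuous.subtype_mk ?_ _
    exact Continuous.smul (Continuous.inv₀ (by fun_prop) fun ε => norm_ne_zero_iff.2 (hne ε))
      (by fun_prop)
  have h0 : proj _ (hne 0) = x := by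
    apply Subtype.ext
    simp [proj]
  have hev : ∀ᶠ ε in nhds (0 : ℝ), proj _ (hne ε) ∈ S := by
    refine hcont.continuousAt.eventually ?_
    change ∀ᶠ y in nhds (proj _ (hne 0)), y ∈ S
    rw [h0]
    exact mem_interior_iff_mem_nhds.1 hx
  obtain ⟨ε, hε, hε0⟩ := ((hev.filter_mono nhdsWithin_le_nhds).and
    (self_mem_nhdsWithin : Set.Ioi (0 : ℝ) ∈ nhdsWithin 0 (Set.Ioi 0))).exists
  refine ⟨_, hε, ?_⟩
  change ⟪m.1, ‖x.1 - ε • m.1‖⁻¹ • (x.1 - ε • m.1)⟫ < 0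
  rw [real_inner_smul_right, inner_sub_right, real_inner_smul_right, hmx, inner_coe_self]
  have := norm_pos_iff.2 (hne ε)
  have hε0 : 0 < ε := hε0
  exact mul_neg_of_pos_of_neg (by positivity) (by linarith)

lemma mem_frontier_hemisphere {m x : Sph d} :
    x ∈ frontier (hemisphere m) ↔ ⟪m.1, x.1⟫ = 0 := by
  have hcl : IsClosed (hemisphere m) := by
    have : hemisphere m = {x : Sph d | 0 ≤ ⟪m.1, x.1⟫} := Set.ext fun x => mem_hemisphere
    rw [this]
    exact isClosed_le continuous_const (by fun_prop)
  rw [hcl.frontier_eq, Set.mem_sdiff, mem_hemisphere]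
  constructor
  · rintro ⟨h1, h2⟩
    by_contra hne
    refine h2 (mem_interior.2 ⟨{y : Sph d | 0 < ⟪m.1, y.1⟫}, fun y hy => ?_,
      isOpen_lt continuous_const (by fun_prop), h1.lt_of_ne' hne⟩)
    exact mem_hemisphere.2 (le_of_lt hy)
  · intro h
    refine ⟨h.ge, fun hint => ?_⟩
    obtain ⟨y, hy, hneg⟩ := exists_inner_neg_of_mem_interior hint h
    exact hneg.not_ge (mem_hemisphere.1 hy)

/-- The center of `bd H(g) ∩ H(h)`. -/
lemma isFaceCenter_iff {g h c : Sph d} (h1 : g ≠ h) (h2 : g ≠ -h) :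
    IsFaceCenter g h c ↔
      c.1 = (√(1 - ⟪g.1, h.1⟫ ^ 2))⁻¹ • (h.1 - ⟪g.1, h.1⟫ • g.1) := by
  obtain ⟨ht1, ht2⟩ := inner_mem_Ioo h1 h2
  set t := ⟪g.1, h.1⟫ with ht
  set s := √(1 - t ^ 2) with hs
  have hs0 : 0 < s := Real.sqrt_pos.2 (by nlinarith)
  have hs2 : s ^ 2 = 1 - t ^ 2 := Real.sq_sqrt (by nlinarith)
  set p := s⁻¹ • (h.1 - t • g.1) with hp
  have hgp : ⟪g.1, p⟫ = 0 := by
    rw [hp, real_inner_smul_right, inner_sub_right, real_inner_smul_right, inner_coe_self, ← ht]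
    ring
  have hpn : ‖p‖ = 1 := by
    have : ‖p‖ ^ 2 = 1 := by
      rw [hp, norm_smul, mul_pow, norm_sub_sq_real, norm_smul, real_inner_smul_right,
        real_inner_comm, ← ht, norm_coe, norm_coe, Real.norm_eq_abs, Real.norm_eq_abs, sq_abs,
        mul_one, sq_abs, inv_pow, hs2]
      have : 1 - t ^ 2 ≠ 0 := by nlinarith
      field_simp
      ring
    exact (pow_eq_one_iff_of_nonneg (norm_nonneg _) two_ne_zero).1 this
  have hhx : ∀ x : Sph d, ⟪g.1, x.1⟫ = 0 → (0 ≤ ⟪h.1, x.1⟫ ↔ 0 ≤ ⟪p, x.1⟫) := fun x hx => by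
    rw [hp, real_inner_smul_left, inner_sub_left, real_inner_smul_left, hx, mul_zero, sub_zero]
    exact (mul_nonneg_iff_of_pos_left (inv_pos.2 hs0)).symm
  have hface : ∀ x : Sph d, x ∈ luneFace g h ↔ ⟪g.1, x.1⟫ = 0 ∧ 0 ≤ ⟪p, x.1⟫ := fun x => by
    rw [luneFace, Set.mem_inter_iff, mem_frontier_hemisphere, mem_hemisphere]
    exact and_congr_right (hhx x)
  have hset : ∀ x : Sph d, x ∈ {x | x ∈ frontier (hemisphere g) ∧ sdist c x ≤ Real.pi / 2} ↔
      ⟪g.1, x.1⟫ = 0 ∧ 0 ≤ ⟪c.1, x.1⟫ := fun x => by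
    change x ∈ frontier (hemisphere g) ∧ x ∈ hemisphere c ↔ _
    rw [mem_frontier_hemisphere, mem_hemisphere]
  rw [IsFaceCenter, mem_frontier_hemisphere, Set.ext_iff]
  simp only [hface, hset]
  constructor
  · rintro ⟨hgc, hall⟩
    by_contra hne
    have hpc : p - c.1 ≠ 0 := fun h0 => hne (sub_eq_zero.1 h0).symm
    have hlt : ⟪p, c.1⟫ < 1 :=
      (inner_lt_one_iff_real_of_norm_eq_one hpn (norm_coe c)).2 fun he => hne he.symm
    have hpos := norm_pos_iff.2 hpc
    -- The direction of `p - c` tells the two hemispheres apart: it lies in the one centered at `p`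
    -- but not in the one centered at `c`.
    have h3 := (hall (proj _ hpc)).1 ⟨?_, ?_⟩
    · have h4 := h3.2
      simp only [proj] at h4
      rw [real_inner_smul_right, inner_sub_right, inner_coe_self, real_inner_comm] at h4
      have := nonneg_of_mul_nonneg_right h4 (inv_pos.2 hpos)
      linarith
    · simp only [proj]
      rw [real_inner_smul_right, inner_sub_right, hgp, hgc]; ring
    · simp only [proj]
      rw [real_inner_smul_right, inner_sub_right, real_inner_self_eq_norm_sq, hpn]
      exact mul_nonneg (by positivity) (by linarith)
  · intro hc
    rw [hc]
    exact ⟨hgp, fun x => Iff.rfl⟩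

/-- The face centers are the normalized components of `h` orthogonal to `g` and of `g` orthogonal to
`h`; their inner product is `-⟪g, h⟫`. -/
lemma isLuneThickness_iff {g h : Sph d} {t : ℝ} :
    IsLuneThickness g h t ↔ g ≠ h ∧ g ≠ -h ∧ t = Real.pi - sdist g h := by
  refine and_congr_right fun h1 => and_congr_right fun h2 => ?_
  have h1' : h ≠ g := h1.symm
  have h2' : h ≠ -g := fun he => h2 (by rw [he, neg_neg])
  obtain ⟨ht1, ht2⟩ := inner_mem_Ioo h1 h2
  simp only [isFaceCenter_iff h1 h2, isFaceCenter_iff h1' h2', real_inner_comm g.1 h.1]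
  set a := ⟪g.1, h.1⟫ with ha
  have hmem : ∀ x y : Sph d, ⟪x.1, y.1⟫ = a →
      (√(1 - a ^ 2))⁻¹ • (y.1 - a • x.1) ∈ Metric.sphere (0 : EuclideanSpace ℝ (Fin (d + 1))) 1 := by
    intro x y hxy
    have hs0 : 0 < √(1 - a ^ 2) := Real.sqrt_pos.2 (by nlinarith)
    have hn : ‖y.1 - a • x.1‖ = √(1 - a ^ 2) := by
      rw [eq_comm, Real.sqrt_eq_iff_eq_sq (by nlinarith) (norm_nonneg _), norm_sub_sq_real,
        norm_smul, real_inner_smul_right, real_inner_comm, hxy, norm_coe, norm_coe,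
        Real.norm_eq_abs, mul_one, sq_abs]; ring
    rw [mem_sphere_zero_iff_norm, norm_smul, hn, norm_inv, Real.norm_eq_abs, abs_of_pos hs0,
      inv_mul_cancel₀ hs0.ne']
  have key : ∀ c c' : Sph d, c.1 = (√(1 - a ^ 2))⁻¹ • (h.1 - a • g.1) →
      c'.1 = (√(1 - a ^ 2))⁻¹ • (g.1 - a • h.1) → sdist c c' = Real.pi - sdist g h := by
    intro c c' hc hc'
    rw [sdist_eq_arccos, sdist_eq_arccos, ← Real.arccos_neg, hc, hc']
    congr 1
    have hs2 : √(1 - a ^ 2) ^ 2 = 1 - a ^ 2 := Real.sq_sqrt (by nlinarith)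
    have hne : 1 - a ^ 2 ≠ 0 := by nlinarith
    have hne' : √(1 - a ^ 2) ≠ 0 := fun h0 => hne (by rw [← hs2, h0]; ring)
    simp only [real_inner_smul_left, real_inner_smul_right, inner_sub_left, inner_sub_right,
      inner_coe_self, real_inner_comm g.1 h.1, ← ha]
    field_simp
    rw [hs2]; ring
  constructor
  · rintro ⟨c, c', hc, hc', rfl⟩
    exact key c c' hc hc'
  · rintro rfl
    exact ⟨⟨_, hmem g h rfl⟩, ⟨_, hmem h g (real_inner_comm _ _)⟩, rfl, rfl,
      (key _ _ rfl rfl).symm⟩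

/-- The points of `C` as unit vectors. -/
def vectors (C : Set (Sph d)) : Set (EuclideanSpace ℝ (Fin (d + 1))) := Subtype.val '' C

/-- The centers of the hemispheres containing `C`, as unit vectors. -/
def dualVectors (C : Set (Sph d)) : Set (EuclideanSpace ℝ (Fin (d + 1))) :=
  {b | ‖b‖ = 1 ∧ ∀ a ∈ C, 0 ≤ ⟪a.1, b⟫}

lemma exists_coe_eq {b : EuclideanSpace ℝ (Fin (d + 1))} (hb : ‖b‖ = 1) : ∃ m : Sph d, m.1 = b :=
  ⟨⟨b, by simpa using hb⟩, rfl⟩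

lemma coe_mem_dualVectors {C : Set (Sph d)} {m : Sph d} :
    m.1 ∈ dualVectors C ↔ C ⊆ hemisphere m := by
  refine ⟨fun h a ha => mem_hemisphere.2 ?_, fun h => ⟨norm_coe m, fun a ha => ?_⟩⟩
  · rw [real_inner_comm]; exact h.2 a ha
  · rw [real_inner_comm]; exact mem_hemisphere.1 (h ha)

/-! ### Convex bodies and their duals. -/

namespace IsConvexBody

variable {W : Set (Sph d)}

lemma inner_pos_of_mem_interior {C : Set (Sph d)} {o : Sph d} (ho : o ∈ interior C)
    {b : EuclideanSpace ℝ (Fin (d + 1))} (hb : b ∈ dualVectors C) : 0 < ⟪o.1, b⟫ := by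
  refine (hb.2 o (interior_subset ho)).lt_of_ne fun h0 => ?_
  obtain ⟨m, rfl⟩ := exists_coe_eq hb.1
  obtain ⟨y, hy, hneg⟩ := exists_inner_neg_of_mem_interior ho (m := m)
    (by rw [real_inner_comm, h0])
  rw [real_inner_comm] at hneg
  exact hneg.not_ge (hb.2 y hy)

lemma normalize_add_smul_mem (hW : IsConvexBody W) {a u : Sph d} (ha : a ∈ W) (hu : u ∈ W)
    {ε : ℝ} (hε : 0 < ε) :
    a.1 + ε • u.1 ≠ 0 ∧ ‖a.1 + ε • u.1‖⁻¹ • (a.1 + ε • u.1) ∈ vectors W := by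
  have hne : a.1 + ε • u.1 ≠ 0 := fun h0 => by
    have h1 : a.1 = -(ε • u.1) := eq_neg_of_add_eq_zero_left h0
    have h2 : ε = 1 := by
      have := congrArg norm h1
      rw [norm_neg, norm_smul, norm_coe, norm_coe, mul_one, Real.norm_eq_abs,
        abs_of_pos hε] at this
      exact this.symm
    rw [h2, one_smul] at h1
    have h3 : a = -u := Subtype.ext (by simpa using h1)
    exact hW.2.1.1 u hu (h3 ▸ ha)
  refine ⟨hne, proj _ hne, hW.2.1.2 a ha u hu ⟨‖a.1 + ε • u.1‖⁻¹, ‖a.1 + ε • u.1‖⁻¹ * ε,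
    by positivity, by positivity, ?_⟩, rfl⟩
  change ‖a.1 + ε • u.1‖⁻¹ • (a.1 + ε • u.1) = _
  rw [smul_add, smul_smul]

/-- A convex body is an intersection of hemispheres. -/
lemma exists_dualVector_inner_neg (hW : IsConvexBody W) {z : Sph d} (hz : z ∉ W) :
    ∃ b ∈ dualVectors W, ⟪z.1, b⟫ < 0 := by
  obtain ⟨o, ho⟩ := hW.2.2
  -- `a` is a point of `W` nearest to `z`; the component of `-z` orthogonal to `a` separates, unless
  -- it vanishes, in which case `a = -z` does.
  obtain ⟨a, ha, hmin⟩ := hW.1.isCompact.exists_isMinOn ⟨o, interior_subset ho⟩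
    (f := fun a : Sph d => ⟪(-z).1, a.1⟫) (by fun_prop)
  have hfv : ∀ u ∈ W, 0 ≤ ⟪(-z).1 - ⟪(-z).1, a.1⟫ • a.1, u.1⟫ := fun u hu =>
    inner_sub_smul_nonneg_of_minimizer (A := vectors W)
      (by rintro _ ⟨u, -, rfl⟩; exact norm_coe u) ⟨a, ha, rfl⟩
      (by rintro _ ⟨u, hu, rfl⟩ ε hε; exact hW.normalize_add_smul_mem ha hu hε)
      (by rintro _ ⟨u, hu, rfl⟩; exact hmin hu) ⟨u, hu, rfl⟩
  set c := ⟪(-z).1, a.1⟫ with hc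
  by_cases h1 : -z = a
  · refine ⟨a.1, ⟨norm_coe a, fun u hu => ?_⟩, ?_⟩
    · have h2 : c ≤ ⟪(-z).1, u.1⟫ := hmin hu
      rw [show c = 1 from (inner_eq_one_iff (-z) a).2 h1] at h2
      rw [← h1, real_inner_comm]
      linarith
    · rw [← h1]
      have := inner_coe_self (-z)
      rw [← neg_neg z.1, inner_neg_left]
      change -⟪(-z).1, (-z).1⟫ < 0
      linarith
  · obtain ⟨h2, h3⟩ := inner_mem_Ioo h1 fun h0 => hz (neg_injective h0 ▸ ha)
    rw [← hc] at h2 h3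
    have hza : ⟪z.1, a.1⟫ = -c := by
      rw [hc, show (-z).1 = -z.1 from rfl, inner_neg_left, neg_neg]
    have hzz : ⟪z.1, (-z).1⟫ = -1 := by
      rw [show (-z).1 = -z.1 from rfl, inner_neg_right, inner_coe_self]
    have hneg : ⟪z.1, (-z).1 - c • a.1⟫ < 0 := by
      rw [inner_sub_right, real_inner_smul_right, hza, hzz]
      nlinarith
    have hne : (-z).1 - c • a.1 ≠ 0 := fun h0 => by
      rw [h0, inner_zero_right] at hneg
      exact hneg.false
    have hpos := norm_pos_iff.2 hne
    refine ⟨_, ⟨norm_coe (proj _ hne), fun u hu => ?_⟩, ?_⟩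
    · have := hfv u hu
      rw [real_inner_comm] at this
      simp only [proj]
      rw [real_inner_smul_right]
      positivity
    · simp only [proj]
      rw [real_inner_smul_right]
      exact mul_neg_of_pos_of_neg (inv_pos.2 hpos) hneg

lemma exists_dualVector_inner_pos (hW : IsConvexBody W) {a : Sph d} (ha : a ∈ W) :
    ∃ b ∈ dualVectors W, 0 < ⟪a.1, b⟫ := by
  obtain ⟨b, hb, hneg⟩ := hW.exists_dualVector_inner_neg (hW.2.1.1 a ha)
  refine ⟨b, hb, ?_⟩
  rw [show (-a).1 = -a.1 from rfl, inner_neg_left] at hneg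
  linarith

/-- Each point of `W` has a dual vector positive near it; by compactness a finite sum of these is
positive on all of `W`. -/
lemma exists_dualVector_forall_pos (hW : IsConvexBody W) :
    ∃ o ∈ dualVectors W, ∀ a ∈ W, 0 < ⟪a.1, o⟫ := by
  choose! f hf hfpos using fun a (ha : a ∈ W) => hW.exists_dualVector_inner_pos ha
  obtain ⟨t, htW, ht⟩ := hW.1.isCompact.elim_nhds_subcover (fun a => {x : Sph d | 0 < ⟪x.1, f a⟫})
    fun a ha => (isOpen_lt continuous_const (by fun_prop)).mem_nhds (hfpos a ha)
  set p := ∑ a ∈ t, f a with hp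
  have hpos : ∀ x ∈ W, 0 < ⟪x.1, p⟫ := fun x hx => by
    obtain ⟨a, hat, hxa⟩ := Set.mem_iUnion₂.1 (ht hx)
    rw [hp, inner_sum]
    exact Finset.sum_pos' (fun b hb => (hf b (htW b hb)).2 x hx) ⟨a, hat, hxa⟩
  obtain ⟨o, ho⟩ := hW.2.2
  have hne : p ≠ 0 := fun h0 => by
    have := hpos o (interior_subset ho)
    rw [h0, inner_zero_right] at this
    exact this.false
  have hn := norm_pos_iff.2 hne
  have hpos' : ∀ x ∈ W, 0 < ⟪x.1, (proj p hne).1⟫ := fun x hx => by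
    have := hpos x hx
    simp only [proj]
    rw [real_inner_smul_right]
    positivity
  exact ⟨_, ⟨norm_coe (proj p hne), fun x hx => (hpos' x hx).le⟩, hpos'⟩

lemma isDualPair (hW : IsConvexBody W) : IsDualPair (vectors W) (dualVectors W) where
  norm_left := by rintro _ ⟨a, -, rfl⟩; exact norm_coe a
  norm_right := fun b hb => hb.1
  mem_left := by
    intro a ha hab
    obtain ⟨a, rfl⟩ := exists_coe_eq ha
    refine ⟨a, ?_, rfl⟩
    by_contra hn
    obtain ⟨b, hb, hneg⟩ := hW.exists_dualVector_inner_neg hn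
    exact hneg.not_ge (hab b hb)
  mem_right := fun b hb hab => ⟨hb, fun a ha => by
    rw [real_inner_comm]; exact hab _ ⟨a, ha, rfl⟩⟩
  nonneg := by rintro _ ⟨a, ha, rfl⟩ b hb; exact hb.2 a ha
  exists_left := by
    obtain ⟨o, ho⟩ := hW.2.2
    exact ⟨o.1, ⟨o, interior_subset ho, rfl⟩, fun b hb => inner_pos_of_mem_interior ho hb⟩
  exists_right := by
    obtain ⟨o, ho, hpos⟩ := hW.exists_dualVector_forall_pos
    refine ⟨o, ho, ?_⟩
    rintro _ ⟨a, ha, rfl⟩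
    rw [real_inner_comm]
    exact hpos a ha

lemma mem_frontier_iff (hW : IsConvexBody W) {a : Sph d} :
    a ∈ frontier W ↔ a ∈ W ∧ ∃ b ∈ dualVectors W, ⟪a.1, b⟫ = 0 := by
  rw [hW.1.frontier_eq, Set.mem_sdiff]
  refine and_congr_right fun ha => ⟨fun hint => ?_, ?_⟩
  · by_contra! hne
    obtain ⟨b₀, hb₀, hmin⟩ := hW.isDualPair.symm.exists_minimizer a.1
    have hη : 0 < ⟪a.1, b₀⟫ := (hb₀.2 a ha).lt_of_ne' (hne b₀ hb₀)
    -- The radius is the least inner product of `a` with dual vectors; these are 1-Lipschitz, so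
    -- none turns negative in the ball.
    refine hint (mem_interior.2 ⟨Metric.ball a ⟪a.1, b₀⟫, fun x hx => ?_, Metric.isOpen_ball,
      Metric.mem_ball_self hη⟩)
    by_contra hxW
    obtain ⟨b, hb, hneg⟩ := hW.exists_dualVector_inner_neg hxW
    have h1 := hmin b hb
    have h2 := real_inner_le_norm (a.1 - x.1) b
    rw [hb.1, mul_one, inner_sub_left, ← dist_eq_norm] at h2
    have h3 : dist x.1 a.1 < ⟪a.1, b₀⟫ := hx
    rw [dist_comm] at h3
    linarith
  · rintro ⟨b, hb, h0⟩ hint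
    exact (inner_pos_of_mem_interior hint hb).ne' h0

lemma supports_iff (hW : IsConvexBody W) {m : Sph d} :
    Supports m W ↔ m.1 ∈ dualVectors W ∧ ∃ a ∈ vectors W, ⟪m.1, a⟫ = 0 := by
  rw [Supports, ← coe_mem_dualVectors]
  refine and_congr_right fun hm => ⟨?_, ?_⟩
  · rintro ⟨a, haW, ham⟩
    exact ⟨a.1, ⟨a, hW.1.frontier_subset haW, rfl⟩, mem_frontier_hemisphere.1 ham⟩
  · rintro ⟨_, ⟨a, ha, rfl⟩, h0⟩
    exact ⟨a, hW.mem_frontier_iff.2 ⟨ha, m.1, hm, by rwa [real_inner_comm]⟩,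
      mem_frontier_hemisphere.2 h0⟩

/-- The sphere is connected for `d ≥ 1`, and `W`, having no antipodes, is not all of it. -/
lemma frontier_nonempty (hd : 1 ≤ d) (hW : IsConvexBody W) : (frontier W).Nonempty := by
  have hrank : 1 < Module.rank ℝ (EuclideanSpace ℝ (Fin (d + 1))) := by
    rw [← Module.finrank_eq_rank, finrank_euclideanSpace_fin]
    exact_mod_cast Nat.lt_succ_of_le hd
  have : PreconnectedSpace (Sph d) :=
    isPreconnected_iff_preconnectedSpace.1 (isPreconnected_sphere hrank 0 1)
  obtain ⟨o, ho⟩ := hW.2.2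
  refine nonempty_frontier_iff.2 ⟨⟨o, interior_subset ho⟩, fun h => ?_⟩
  exact hW.2.1.1 o (interior_subset ho) (h ▸ Set.mem_univ _)

/-! ### Constant diameter and constant width in terms of the dual pair. -/

/-- Constant diameter in terms of inner products. -/
lemma isOfConstantDiameter_iff (hd : 1 ≤ d) (hW : IsConvexBody W) {w : ℝ} :
    IsOfConstantDiameter W w ↔ w ∈ Set.Ioo 0 Real.pi ∧
      HasConstDiam (vectors W) (dualVectors W) (Real.cos w) := by
  obtain ⟨p, hp⟩ := hW.frontier_nonempty hd
  have hpW := hW.1.frontier_subset hp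
  constructor
  · rintro ⟨hdiam, hbd⟩
    obtain ⟨q, hq, hpq⟩ := hbd p hp
    have hwI : w ∈ Set.Icc 0 Real.pi := hpq ▸ sdist_mem_Icc p q
    have hle : ∀ a ∈ W, ∀ a' ∈ W, Real.cos w ≤ ⟪a.1, a'.1⟫ := fun a ha a' ha' =>
      (sdist_le_iff hwI a a').1 (hdiam.1 ⟨a, ha, a', ha', rfl⟩)
    have hwpi : w ≠ Real.pi := by
      rintro rfl
      rw [sdist_eq_iff hwI, Real.cos_pi, inner_eq_neg_one_iff] at hpq
      exact hW.2.1.1 q hq (hpq ▸ hpW)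
    have hw0 : w ≠ 0 := by
      rintro rfl
      obtain ⟨o, ho⟩ := hW.2.2
      have h1 := hle p hpW o (interior_subset ho)
      rw [Real.cos_zero] at h1
      have h2 := (inner_eq_one_iff p o).1 (le_antisymm (abs_le.1 (abs_inner_le_one p o)).2 h1)
      exact hp.2 (h2 ▸ ho)
    refine ⟨⟨hwI.1.lt_of_ne' hw0, hwI.2.lt_of_ne hwpi⟩, ?_, ?_⟩
    · rintro _ ⟨a, ha, rfl⟩ _ ⟨a', ha', rfl⟩
      exact hle a ha a' ha'
    · rintro _ ⟨a, ha, rfl⟩ b hb hab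
      obtain ⟨q, hq, haq⟩ := hbd a (hW.mem_frontier_iff.2 ⟨ha, b, hb, hab⟩)
      exact ⟨q.1, ⟨q, hq, rfl⟩, (sdist_eq_iff hwI a q).1 haq⟩
  · rintro ⟨hw, hle, hbd⟩
    have hwI := Set.Ioo_subset_Icc_self hw
    have hbd' : ∀ a ∈ frontier W, ∃ q ∈ W, sdist a q = w := fun a ha => by
      obtain ⟨haW, b, hb, hab⟩ := hW.mem_frontier_iff.1 ha
      obtain ⟨_, ⟨q, hq, rfl⟩, haq⟩ := hbd a.1 ⟨a, haW, rfl⟩ b hb hab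
      exact ⟨q, hq, (sdist_eq_iff hwI a q).2 haq⟩
    refine ⟨IsGreatest.isLUB ⟨?_, ?_⟩, hbd'⟩
    · obtain ⟨q, hq, hpq⟩ := hbd' p hp
      exact ⟨p, hpW, q, hq, hpq.symm⟩
    · rintro _ ⟨a, ha, a', ha', rfl⟩
      exact (sdist_le_iff hwI a a').2 (hle _ ⟨a, ha, rfl⟩ _ ⟨a', ha', rfl⟩)

/-- A convex body has constant width `w` exactly if its dual has constant diameter `π - w`. -/
lemma isOfConstantWidth_iff (hd : 1 ≤ d) (hW : IsConvexBody W) {w : ℝ} :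
    IsOfConstantWidth W w ↔ w ∈ Set.Ioo 0 Real.pi ∧
      HasConstDiam (dualVectors W) (vectors W) (-Real.cos w) := by
  have hP := hW.isDualPair
  constructor
  · intro hcw
    have hw : w ∈ Set.Ioo 0 Real.pi := by
      obtain ⟨p, hp⟩ := hW.frontier_nonempty hd
      obtain ⟨hpW, b, hb, hpb⟩ := hW.mem_frontier_iff.1 hp
      obtain ⟨k, rfl⟩ := exists_coe_eq hb.1
      obtain ⟨⟨m, -, hm⟩, -⟩ := hcw k (hW.supports_iff.2 ⟨hb, p.1, ⟨p, hpW, rfl⟩,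
        by rwa [real_inner_comm]⟩)
      obtain ⟨h1, h2, rfl⟩ := isLuneThickness_iff.1 hm
      have hI := sdist_mem_Icc k m
      have h3 : sdist k m ≠ 0 := fun h0 => h1 <| by
        rw [sdist_eq_iff ⟨le_rfl, Real.pi_nonneg⟩, Real.cos_zero] at h0
        exact (inner_eq_one_iff k m).1 h0
      have h4 : sdist k m ≠ Real.pi := fun h0 => h2 <| by
        rw [sdist_eq_iff ⟨Real.pi_nonneg, le_rfl⟩, Real.cos_pi] at h0
        exact (inner_eq_neg_one_iff k m).1 h0
      exact ⟨sub_pos.2 (hI.2.lt_of_ne h4), sub_lt_self _ (hI.1.lt_of_ne' h3)⟩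
    refine ⟨hw, ?_, ?_⟩
    -- Constant width tests supporting hemispheres only, that is, boundary points of the dual; these
    -- suffice.
    · refine hP.symm.le_inner_of_boundary (by linarith [Real.neg_one_le_cos w])
        fun k hk m hm a ha a' ha' hka hma' hkm _ => ?_
      obtain ⟨k, rfl⟩ := exists_coe_eq hk.1
      obtain ⟨m, rfl⟩ := exists_coe_eq hm.1
      have h1 : k ≠ m := fun h => hkm (congrArg _ h)
      have h2 : k ≠ -m := fun h => hP.symm.neg_notMem hm (by rw [h] at hk; exact hk)
      have := (hcw k (hW.supports_iff.2 ⟨hk, a, ha, hka⟩)).2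
        ⟨m, hW.supports_iff.2 ⟨hm, a', ha', hma'⟩, isLuneThickness_iff.2 ⟨h1, h2, rfl⟩⟩
      rw [← Real.cos_pi_sub]
      refine (sdist_le_iff ⟨by linarith [hw.2], by linarith [hw.1]⟩ k m).1 (by linarith)
    · intro k hk a ha hka
      obtain ⟨k, rfl⟩ := exists_coe_eq hk.1
      obtain ⟨⟨m, hm, hkm⟩, -⟩ := hcw k (hW.supports_iff.2 ⟨hk, a, ha, hka⟩)
      obtain ⟨-, -, rfl⟩ := isLuneThickness_iff.1 hkm
      refine ⟨m.1, (hW.supports_iff.1 hm).1, ?_⟩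
      rw [Real.cos_pi_sub, neg_neg, cos_sdist]
  · rintro ⟨hw, hle, hbd⟩ k hk
    obtain ⟨hkd, a, ha, hka⟩ := hW.supports_iff.1 hk
    have hwI : Real.pi - w ∈ Set.Icc 0 Real.pi := ⟨by linarith [hw.2], by linarith [hw.1]⟩
    constructor
    · obtain ⟨m, hm, hkm⟩ := hbd _ hkd a ha hka
      obtain ⟨m, rfl⟩ := exists_coe_eq hm.1
      have hlt : ⟪k.1, m.1⟫ < 1 := by
        rw [hkm, ← Real.cos_pi_sub, ← Real.cos_zero]
        exact Real.cos_lt_cos_of_nonneg_of_le_pi le_rfl (by linarith [hw.1]) (by linarith [hw.2])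
      have hgt := hP.symm.neg_one_lt_inner hkd hm
      -- `m` is farthest from `k` in the dual, hence a boundary point of it, so its hemisphere
      -- supports `W`.
      have hsup := hP.symm.supporting_mem hm (norm_coe k)
        (fun u hu => hkm.le.trans (hle _ hkd u hu)) hgt hlt
      refine ⟨m, hW.supports_iff.2 ⟨hm, _, hsup, hP.symm.inner_supporting hm _⟩,
        isLuneThickness_iff.2 ⟨fun h => ?_, fun h => ?_, ?_⟩⟩
      · exact hlt.ne ((inner_eq_one_iff k m).2 h)
      · exact hgt.ne' ((inner_eq_neg_one_iff k m).2 h)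
      · rw [(sdist_eq_iff hwI k m).2 (by rw [hkm, Real.cos_pi_sub])]; ring
    · rintro t ⟨m, hm, hkm⟩
      obtain ⟨-, -, rfl⟩ := isLuneThickness_iff.1 hkm
      have := (sdist_le_iff hwI k m).2 (by
        rw [Real.cos_pi_sub]; exact hle _ hkd _ (hW.supports_iff.1 hm).1)
      linarith

/-- Constant width and constant diameter are equivalent. -/
theorem isOfConstantWidth_iff_isOfConstantDiameter (hd : 1 ≤ d) (hW : IsConvexBody W) {w : ℝ} :
    IsOfConstantWidth W w ↔ IsOfConstantDiameter W w := by
  rw [hW.isOfConstantWidth_iff hd, hW.isOfConstantDiameter_iff hd]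
  refine and_congr_right fun hw => ?_
  have h1 : Real.cos w < 1 := by
    rw [← Real.cos_zero]
    exact Real.cos_lt_cos_of_nonneg_of_le_pi le_rfl hw.2.le hw.1
  have h2 : -1 < Real.cos w := by
    rw [← Real.cos_pi]
    exact Real.cos_lt_cos_of_nonneg_of_le_pi hw.1.le le_rfl hw.2
  refine ⟨fun h => ?_, fun h => hW.isDualPair.hasConstDiam_dual h2 h1 h⟩
  rw [← neg_neg (Real.cos w)]
  exact hW.isDualPair.symm.hasConstDiam_dual (by linarith) (by linarith) h

end IsConvexBody

end SphConvex

theorem mainTheorem6 (d : ℕ) (hd : 2 ≤ d) (W : Set (SphConvex.Sph d))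
    (hW : SphConvex.IsConvexBody W) (w : ℝ) :
    (SphConvex.IsOfConstantWidth W w → SphConvex.IsOfConstantDiameter W w) ∧
      (Real.pi / 2 ≤ w → SphConvex.IsOfConstantDiameter W w →
        SphConvex.IsOfConstantWidth W w) :=
  have h := hW.isOfConstantWidth_iff_isOfConstantDiameter (one_le_two.trans hd) (w := w)
  ⟨h.1, fun _ => h.2⟩
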